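/- Let $q$ be a prime power and $d\ge 2$ an even integer, and let $\Omega$ be the set of generators (totally singular subspaces of vector space dimension $d$) of the hyperbolic quadric $Q^+(2d-1,q)$. For $0\le i\le d$ let $A_i$ be the $\Omega\times\Omega$ $0/1$-matrix with $(A_i)_{\pi,\pi'}=1$ if and only if $\pi\cap\pi'$ has vector space dimension $d-i$. For $0\le i,j\le d$ put $$P_{j,i}=\sum_{s=\max(0,j-i)}^{\min(j,d-i)}(-1)^{j+s}\begin{bmatrix} j\\ s\end{bmatrix}_q\begin{bmatrix} d-j\\ d-i-s\end{bmatrix}_q q^{\binom{j-s}{2}+\binom{i+s-j}{2}},$$ where $\begin{bmatrix} a\\ b\end{bmatrix}_q$ is the Gaussian binomial coefficient, and let $V_j=\{v\in\mathbb{R}^\Omega : A_iv=P_{j,i}v \text{ for } 0\le i\le d\}$. Let $\mathcal{G}$ be one of the two classes of generators, i.e. $\mathcal G$ consists of all $\pi\in\Omega$ for which the vector space dimension of $\pi_0\cap\pi$ is congruent to $d$ modulo $2$, for some fixed generator $\pi_0$. Let $A'_i$ be the restriction of $A_{2i}$ to the rows and columns belonging to $\mathcal{G}$, and let $V'_j\subseteq\mathbb{R}^{\mathcal{G}}$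 be the restriction to $\mathcal{G}$ (the image under the coordinate restriction $\mathbb R^\Omega\to\mathbb R^{\mathcal G}$) of $V_j+V_{d-j}$, for $0\le j\le d/2$. Then $\mathbb{R}^\Omega=V_0\perp V_1\perp\cdots\perp V_d$, and for every $i$ with $1\le i\le d/2$ the eigenvalue $P_{1,2i}$ of $A'_i$ corresponds only to $V'_1$. That is, each $V'_j$ $(0\le j\le d/2)$ is nonzero, $A'_i$ acts on $V'_j$ as multiplication by $P_{j,2i}$, we have $P_{j,2i}=P_{1,2i}$ if and only if $j=1$, and the eigenspace of $A'_i$ for the eigenvalue $P_{1,2i}$ is exactly $V'_1$. -/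

import Mathlib

namespace HyperbolicQuadric

variable {F V : Type*} [Field F] [AddCommGroup V] [Module F V]

/-- `Q` defines the hyperbolic quadric `Q⁺(2d-1,q)` in `PG(V)`: `V` has vector space dimension
`2d`, `Q` is nondegenerate, and there is a totally singular subspace of dimension `d`. -/
structure IsHyperbolic (Q : QuadraticForm F V) (d : ℕ) : Prop where
  finrank_eq : Module.finrank F V = 2 * d
  nondegenerate : Q.Nondegenerate
  exists_singular : ∃ W : Submodule F V, (∀ x ∈ W, Q x = 0) ∧ Module.finrank F W = d

/-- The subspaces of the polar space of `Q`: the totally singular subspaces. -/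
def IsTotallySingular (Q : QuadraticForm F V) (W : Submodule F V) : Prop :=
  ∀ x ∈ W, Q x = 0

/-- The generators: totally singular subspaces of maximal dimension. -/
def Generator (Q : QuadraticForm F V) : Type _ :=
  {W : Submodule F V // IsTotallySingular Q W ∧
    ∀ U : Submodule F V, IsTotallySingular Q U → Module.finrank F U ≤ Module.finrank F W}

/-- The vector space dimension of the intersection of two generators (this is the projective
dimension plus one). -/
noncomputable def interDim {Q : QuadraticForm F V} (π π' : Generator Q) : ℕ :=
  Module.finrank F (π.1 ⊓ π'.1 : Submodule F V)

/-- The class of the generator `π₀`: all generators meeting `π₀` in a subspace whose vector space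
dimension is congruent to `d` modulo `2`. -/
def GenClass (Q : QuadraticForm F V) (d : ℕ) (π₀ : Generator Q) : Type _ :=
  {π : Generator Q // interDim π₀ π ≡ d [MOD 2]}

section Finiteness

variable [Finite F] [FiniteDimensional F V]

noncomputable instance (Q : QuadraticForm F V) : Fintype (Generator Q) :=
  haveI : Finite V := Module.finite_of_finite F
  haveI : Finite (Generator Q) := Subtype.finite
  Fintype.ofFinite _

noncomputable instance (Q : QuadraticForm F V) (d : ℕ) (π₀ : Generator Q) :
    Fintype (GenClass Q d π₀) :=
  haveI : Finite (GenClass Q d π₀) := Subtype.finite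
  Fintype.ofFinite _

end Finiteness

/-- The matrix `A_i` of the relation `R_i`: `(π, π') ∈ R_i` if and only if `π ∩ π'` has projective
dimension `d - i - 1`, that is, vector space dimension `d - i`. -/
noncomputable def relMatrix (Q : QuadraticForm F V) (d i : ℕ) :
    Matrix (Generator Q) (Generator Q) ℝ :=
  Matrix.of fun π π' => if interDim π π' + i = d then 1 else 0

/-- The matrix `A'_i`: the rows and columns of `A_{2i}` that belong to the class of `π₀`. -/
noncomputable def classMatrix (Q : QuadraticForm F V) (d : ℕ) (π₀ : Generator Q) (i : ℕ) :
    Matrix (GenClass Q d π₀) (GenClass Q d π₀) ℝ :=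
  (relMatrix Q d (2 * i)).submatrix Subtype.val Subtype.val

/-- The Gaussian binomial coefficient
`(q^a - 1)⋯(q^(a-b+1) - 1) / ((q^b - 1)⋯(q - 1))`. -/
noncomputable def gaussBinom (q a b : ℕ) : ℝ :=
  ∏ k ∈ Finset.range b, ((q : ℝ) ^ (a - k) - 1) / ((q : ℝ) ^ (k + 1) - 1)

/-- The eigenvalue `P_{ji}` of the association scheme of generators of a polar space of rank `d`
over the field with `q` elements, for the parameter `e = 0` of the hyperbolic quadric. -/
noncomputable def eigenP (q d j i : ℕ) : ℝ :=
  ∑ s ∈ Finset.Icc (j - i) (min j (d - i)),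
    (-1 : ℝ) ^ (j + s) * gaussBinom q j s * gaussBinom q (d - j) (d - i - s) *
      (q : ℝ) ^ ((j - s).choose 2 + (i + s - j).choose 2)

section Eigenspaces

variable [Finite F] [FiniteDimensional F V]

/-- `V_j`: the common eigenspace of `A_0, …, A_d` for the eigenvalues `P_{j0}, …, P_{jd}`. -/
noncomputable def schemeSpace (Q : QuadraticForm F V) (d j : ℕ) :
    Submodule ℝ (Generator Q → ℝ) :=
  ⨅ i ∈ Finset.range (d + 1),
    Module.End.eigenspace (relMatrix Q d i).mulVecLin (eigenP (Nat.card F) d j i)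

/-- `V'_j`: the restriction of `V_j + V_{d-j}` to the class of `π₀`. -/
noncomputable def classSpace (Q : QuadraticForm F V) (d : ℕ) (π₀ : Generator Q) (j : ℕ) :
    Submodule ℝ (GenClass Q d π₀ → ℝ) :=
  (schemeSpace Q d j ⊔ schemeSpace Q d (d - j)).map
    (LinearMap.funLeft ℝ ℝ (Subtype.val : GenClass Q d π₀ → Generator Q))

end Eigenspaces

end HyperbolicQuadric

/-!
The dual polar graph of `Q⁺(2d-1,q)` joins two generators that meet in dimension `d - 1`.

*Geometry.* If `ρ` and `σ` are adjacent, then `(ρ ∩ σ)^⊥ / (ρ ∩ σ)` is a hyperbolic line, whose only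
singular points are `ρ` and `σ`. Hence the distances from any `π` to `ρ` and to `σ` differ by exactly
one (`IsHyperbolic.interDim_of_adj`): the graph is bipartite, and the classes of generators are the
two colour classes. Double counting vectors of `π \ ρ` gives the intersection numbers
`c_i = (q^i - 1) / (q - 1)` and `b_i = (q^d - q^i) / (q - 1)`, that is, a three-term recurrence for
`A_1 A_{i+1}` (`IsHyperbolic.relMatrix_one_mul`), so that `A_i = p_i(A_1)` for polynomials `p_i`.

*Eigenvalues.* By the `q`-binomial theorem, `P_{j,i}` is the coefficient of `X^i` in
`∏_{k < j} (1 - q^k X) ∏_{k < d - j} (1 + q^k X)` (`eigenP_eq_coeff`). The `q`-difference equation of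
this product is the same three-term recurrence, whence `P_{j,i} = p_i(P_{j,1})`. The product has degree `d`,
so `p_{d+1}` vanishes at the `d + 1` distinct numbers `P_{j,1}`; since `p_{d+1}(A_1) = A_{d+1} = 0`,
Lagrange interpolation at these numbers decomposes the whole space into the `V_j`
(`IsHyperbolic.exists_decomposition`). Symmetry of `A_1` yields orthogonality.

*The eigenvalue `P_{1,2i}`.* Replacing `X` by `-X` shows `P_{d-j,2i} = P_{j,2i}`. For `i = 1` the values
`P_{j,2}`, `j ≤ d/2`, are distinct as `P_{j,2}` is an increasing function of `P_{j,1}^2`. For `i ≥ 2`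
and `j ≤ d/2` the exact power of `q` in `P_{j,2i}` is `i (i - 1) + (i - min i j)^2`, attained by a
single term of the alternating sum; this exponent takes its value at `j = 1` only there
(`eigenP_eq_eigenP_one_iff`).
As `A_{2i}` preserves the classes, an eigenvector of `A'_i` extended by zero is one of `A_{2i}`, and
its components lie in `V_1` and `V_{d-1}` (`IsHyperbolic.eigenspace_le_classSpace_one`).
-/

namespace HyperbolicQuadric

/-! ### Generators of the hyperbolic quadric -/

section Geometry

variable {F V : Type*} [Field F] [AddCommGroup V] [Module F V]

/-- The orthogonal complement of `W` with respect to the polar form of `Q`. -/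
def perp (Q : QuadraticForm F V) (W : Submodule F V) : Submodule F V :=
  LinearMap.BilinForm.orthogonal Q.polarBilin W

lemma mem_perp {Q : QuadraticForm F V} {W : Submodule F V} {x : V} :
    x ∈ perp Q W ↔ ∀ w ∈ W, QuadraticMap.polar Q w x = 0 := Iff.rfl

lemma perp_anti {Q : QuadraticForm F V} {U W : Submodule F V} (h : U ≤ W) :
    perp Q W ≤ perp Q U := fun _ hx w hw => hx w (h hw)

lemma perp_sup (Q : QuadraticForm F V) (U W : Submodule F V) :
    perp Q (U ⊔ W) = perp Q U ⊓ perp Q W := by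
  refine le_antisymm (le_inf (perp_anti le_sup_left) (perp_anti le_sup_right)) ?_
  rintro x ⟨hU, hW⟩ w hw
  obtain ⟨u, hu, w', hw', rfl⟩ := Submodule.mem_sup.1 hw
  have h1 := mem_perp.1 hU u hu
  have h2 := mem_perp.1 hW w' hw'
  simp [h1, h2]

lemma mem_perp_span_singleton {Q : QuadraticForm F V} {v x : V} :
    x ∈ perp Q (F ∙ v) ↔ QuadraticMap.polar Q v x = 0 := by
  refine ⟨fun h => mem_perp.1 h v (Submodule.mem_span_singleton_self v), fun h => ?_⟩
  refine mem_perp.2 fun w hw => ?_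
  obtain ⟨a, rfl⟩ := Submodule.mem_span_singleton.1 hw
  simp [h, QuadraticMap.polar_smul_left]

lemma IsTotallySingular.polar_eq_zero {Q : QuadraticForm F V} {W : Submodule F V}
    (hW : IsTotallySingular Q W) {x y : V} (hx : x ∈ W) (hy : y ∈ W) :
    QuadraticMap.polar Q x y = 0 := by
  simp [QuadraticMap.polar, hW _ hx, hW _ hy, hW _ (W.add_mem hx hy)]

lemma IsTotallySingular.le_perp {Q : QuadraticForm F V} {W : Submodule F V}
    (hW : IsTotallySingular Q W) : W ≤ perp Q W :=
  fun _ hx => mem_perp.2 fun _ hw => hW.polar_eq_zero hw hx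

lemma IsTotallySingular.sup_span {Q : QuadraticForm F V} {W : Submodule F V}
    (hW : IsTotallySingular Q W) {v : V} (hv : Q v = 0) (hvW : v ∈ perp Q W) :
    IsTotallySingular Q (W ⊔ F ∙ v) := by
  intro x hx
  obtain ⟨w, hw, y, hy, rfl⟩ := Submodule.mem_sup.1 hx
  obtain ⟨a, rfl⟩ := Submodule.mem_span_singleton.1 hy
  rw [QuadraticMap.map_add (⇑Q), QuadraticMap.polar_smul_right, QuadraticMap.map_smul,
    mem_perp.1 hvW w hw, hW w hw, hv]
  simp

lemma interDim_comm {Q : QuadraticForm F V} (π ρ : Generator Q) : interDim π ρ = interDim ρ π := by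
  unfold interDim; rw [inf_comm]

lemma le_or_le_of_forall_mem_or_mem {U A B : Submodule F V} (h : ∀ v ∈ U, v ∈ A ∨ v ∈ B) :
    U ≤ A ∨ U ≤ B := by
  by_contra! hc
  obtain ⟨x, hx, hxA⟩ := SetLike.not_le_iff_exists.1 hc.1
  obtain ⟨y, hy, hyB⟩ := SetLike.not_le_iff_exists.1 hc.2
  have hxB := (h x hx).resolve_left hxA
  have hyA := (h y hy).resolve_right hyB
  rcases h _ (U.add_mem hx hy) with hs | hs
  · exact hxA ((Submodule.add_mem_iff_left _ hyA).1 hs)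
  · exact hyB ((Submodule.add_mem_iff_right _ hxB).1 hs)

lemma finrank_sup_span_singleton [FiniteDimensional F V] {W : Submodule F V} {v : V}
    (hv : v ∉ W) : Module.finrank F (W ⊔ F ∙ v : Submodule F V) = Module.finrank F W + 1 := by
  have h := Submodule.finrank_sup_add_finrank_inf_eq W (F ∙ v)
  have hv0 : v ≠ 0 := fun h0 => hv (h0 ▸ W.zero_mem)
  have hd : W ⊓ F ∙ v = ⊥ :=
    disjoint_iff.1 ((Submodule.disjoint_span_singleton' hv0).2 hv)
  rw [hd, finrank_bot, finrank_span_singleton hv0] at h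
  omega

variable [FiniteDimensional F V] {Q : QuadraticForm F V} {d : ℕ}

/-- The polar form of a hyperbolic quadric is nondegenerate in every characteristic: a totally
singular `W` of dimension `d` equals its own orthogonal complement, so it contains the kernel of
the polar form, on which `Q` therefore vanishes. -/
lemma IsHyperbolic.ker_polarBilin (hQ : IsHyperbolic Q d) : Q.polarBilin.ker = ⊥ := by
  obtain ⟨W, hW, hWd⟩ := hQ.exists_singular
  have hinf : W ⊓ Q.polarBilin.ker = ⊥ := by
    rw [eq_bot_iff, ← hQ.nondegenerate.radical_eq_bot]
    exact fun x hx => ⟨hW x hx.1, hx.2⟩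
  have h := LinearMap.BilinForm.finrank_add_finrank_orthogonal' (B := Q.polarBilin) W
  rw [hinf, finrank_bot, hQ.finrank_eq, hWd] at h
  have hle : W ≤ perp Q W := IsTotallySingular.le_perp hW
  have heq : W = perp Q W := Submodule.eq_of_le_of_finrank_le hle (by
    rw [hWd]; change Module.finrank F (LinearMap.BilinForm.orthogonal Q.polarBilin W) ≤ d; omega)
  have hker : Q.polarBilin.ker ≤ W := by
    rw [heq]
    intro x hx
    refine mem_perp.2 fun w _ => ?_
    rw [QuadraticMap.polar_comm]
    exact LinearMap.congr_fun (LinearMap.mem_ker.1 hx) w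
  rw [← hinf, inf_eq_right.2 hker]

lemma IsHyperbolic.finrank_perp (hQ : IsHyperbolic Q d) (W : Submodule F V) :
    Module.finrank F W + Module.finrank F (perp Q W) = 2 * d := by
  have h := LinearMap.BilinForm.finrank_add_finrank_orthogonal' (B := Q.polarBilin) W
  rwa [hQ.ker_polarBilin, inf_bot_eq, finrank_bot, hQ.finrank_eq] at h

lemma IsHyperbolic.finrank_le (hQ : IsHyperbolic Q d) {W : Submodule F V}
    (hW : IsTotallySingular Q W) : Module.finrank F W ≤ d := by
  have h1 := hQ.finrank_perp W
  have h2 := Submodule.finrank_mono hW.le_perp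
  omega

lemma IsHyperbolic.finrank_generator (hQ : IsHyperbolic Q d) (π : Generator Q) :
    Module.finrank F π.1 = d := by
  obtain ⟨W, hW, hWd⟩ := hQ.exists_singular
  exact le_antisymm (hQ.finrank_le π.2.1) (hWd ▸ π.2.2 W hW)

lemma IsHyperbolic.perp_generator (hQ : IsHyperbolic Q d) (π : Generator Q) :
    perp Q π.1 = π.1 := by
  refine (Submodule.eq_of_le_of_finrank_le π.2.1.le_perp ?_).symm
  have h := hQ.finrank_perp π.1
  have := hQ.finrank_generator π
  omega

lemma IsHyperbolic.generator_eq_of_le (hQ : IsHyperbolic Q d) {π ρ : Generator Q}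
    (h : π.1 ≤ ρ.1) : π = ρ :=
  Subtype.ext (Submodule.eq_of_le_of_finrank_eq h
    ((hQ.finrank_generator π).trans (hQ.finrank_generator ρ).symm))

lemma IsHyperbolic.interDim_self (hQ : IsHyperbolic Q d) (π : Generator Q) :
    interDim π π = d := by
  unfold interDim; rw [inf_idem]; exact hQ.finrank_generator π

lemma IsHyperbolic.interDim_le (hQ : IsHyperbolic Q d) (π ρ : Generator Q) :
    interDim π ρ ≤ d :=
  (Submodule.finrank_mono inf_le_left).trans (hQ.finrank_generator π).le

lemma IsHyperbolic.eq_of_interDim_eq (hQ : IsHyperbolic Q d) {π ρ : Generator Q}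
    (h : interDim π ρ = d) : π = ρ := by
  refine hQ.generator_eq_of_le (inf_eq_left.1 (Submodule.eq_of_le_of_finrank_le inf_le_left ?_))
  exact (hQ.finrank_generator π).trans_le h.ge

/-- The two adjacent generators `ρ` and `σ` contain all singular vectors that are orthogonal to
their intersection: the quotient of `(ρ ∩ σ)^⊥` by `ρ ∩ σ` is a hyperbolic line. -/
lemma IsHyperbolic.mem_or_mem_of_mem_perp (hQ : IsHyperbolic Q d) {ρ σ : Generator Q}
    (h : interDim ρ σ + 1 = d) {v : V} (hv : Q v = 0) (hvH : v ∈ perp Q (ρ.1 ⊓ σ.1)) :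
    v ∈ ρ.1 ∨ v ∈ σ.1 := by
  have hsup : ρ.1 ⊔ σ.1 = perp Q (ρ.1 ⊓ σ.1) := by
    refine Submodule.eq_of_le_of_finrank_le (sup_le ?_ ?_) ?_
    · exact ρ.2.1.le_perp.trans (perp_anti inf_le_left)
    · exact σ.2.1.le_perp.trans (perp_anti inf_le_right)
    · have h1 := Submodule.finrank_sup_add_finrank_inf_eq ρ.1 σ.1
      have h2 := hQ.finrank_perp (ρ.1 ⊓ σ.1)
      have h3 := hQ.finrank_generator ρ
      have h4 := hQ.finrank_generator σ
      unfold interDim at h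
      omega
  rw [← hsup] at hvH
  obtain ⟨x, hx, y, hy, rfl⟩ := Submodule.mem_sup.1 hvH
  rw [QuadraticMap.map_add (⇑Q), ρ.2.1 x hx, σ.2.1 y hy, zero_add, zero_add] at hv
  by_cases hxσ : x ∈ σ.1
  · exact Or.inr (σ.1.add_mem hxσ hy)
  left
  refine ρ.1.add_mem hx ?_
  -- `x` and `ρ ∩ σ` span `ρ`, and both are orthogonal to `y`.
  have hspan : (ρ.1 ⊓ σ.1) ⊔ F ∙ x = ρ.1 := by
    refine Submodule.eq_of_le_of_finrank_le
      (sup_le inf_le_left ((Submodule.span_singleton_le_iff_mem _ _).2 hx)) ?_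
    rw [finrank_sup_span_singleton (W := ρ.1 ⊓ σ.1) fun hm => hxσ hm.2, hQ.finrank_generator ρ]
    exact h.ge
  rw [← hQ.perp_generator ρ, ← hspan, perp_sup]
  exact ⟨perp_anti inf_le_right (σ.2.1.le_perp hy), mem_perp_span_singleton.2 hv⟩

lemma IsHyperbolic.interDim_of_inf_perp_le (hQ : IsHyperbolic Q d) {π ρ σ : Generator Q}
    (h : interDim ρ σ + 1 = d) (hle : π.1 ⊓ perp Q (ρ.1 ⊓ σ.1) ≤ ρ.1) :
    π.1 ⊓ σ.1 ≤ ρ.1 ∧ interDim π ρ = interDim π σ + 1 := by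
  set H := ρ.1 ⊓ σ.1 with hH
  have hρ : ρ.1 ≤ perp Q H := ρ.2.1.le_perp.trans (perp_anti inf_le_left)
  have hσ : σ.1 ≤ perp Q H := σ.2.1.le_perp.trans (perp_anti inf_le_right)
  have h1 : π.1 ⊓ perp Q H = π.1 ⊓ ρ.1 :=
    le_antisymm (le_inf inf_le_left hle) (inf_le_inf_left _ hρ)
  have h2 : π.1 ⊓ σ.1 ≤ ρ.1 := (inf_le_inf_left _ hσ).trans hle
  have h3 : π.1 ⊓ σ.1 = π.1 ⊓ H :=
    le_antisymm (le_inf inf_le_left (le_inf h2 inf_le_right)) (inf_le_inf_left _ inf_le_right)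
  refine ⟨h2, ?_⟩
  have e1 := Submodule.finrank_sup_add_finrank_inf_eq π.1 H
  have e2 := hQ.finrank_perp (π.1 ⊔ H)
  rw [perp_sup, hQ.perp_generator, h1] at e2
  rw [← h3] at e1
  have e3 := hQ.finrank_generator π
  unfold interDim at *
  rw [← hH] at h
  omega

/-- The intersections of a generator with two adjacent generators are nested, and their
dimensions differ by exactly one. -/
lemma IsHyperbolic.interDim_of_adj (hQ : IsHyperbolic Q d) (π : Generator Q) {ρ σ : Generator Q}
    (h : interDim ρ σ + 1 = d) :
    (π.1 ⊓ σ.1 ≤ ρ.1 ∧ interDim π ρ = interDim π σ + 1) ∨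
      (π.1 ⊓ ρ.1 ≤ σ.1 ∧ interDim π σ = interDim π ρ + 1) := by
  rcases le_or_le_of_forall_mem_or_mem (U := π.1 ⊓ perp Q (ρ.1 ⊓ σ.1)) (A := ρ.1) (B := σ.1)
    fun v hv => hQ.mem_or_mem_of_mem_perp h (π.2.1 v hv.1) hv.2 with hle | hle
  · exact Or.inl (hQ.interDim_of_inf_perp_le h hle)
  · rw [inf_comm ρ.1] at hle
    exact Or.inr (hQ.interDim_of_inf_perp_le (by rwa [interDim_comm]) hle)

/-- The only generator adjacent to `ρ` through a singular vector `v ∉ ρ` is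
`⟨ρ ∩ v^⊥, v⟩`. -/
lemma IsHyperbolic.existsUnique_adj (hQ : IsHyperbolic Q d) (ρ : Generator Q) {v : V}
    (hv : Q v = 0) (hvρ : v ∉ ρ.1) :
    ∃! σ : Generator Q, interDim ρ σ + 1 = d ∧ v ∈ σ.1 := by
  have hH : Module.finrank F (ρ.1 ⊓ perp Q (F ∙ v) : Submodule F V) + 1 = d := by
    have h1 := finrank_sup_span_singleton hvρ
    have h2 := hQ.finrank_perp (ρ.1 ⊔ F ∙ v)
    rw [perp_sup, hQ.perp_generator] at h2
    have := hQ.finrank_generator ρ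
    omega
  have hvH : v ∉ ρ.1 ⊓ perp Q (F ∙ v) := fun hm => hvρ hm.1
  have hsing : IsTotallySingular Q ((ρ.1 ⊓ perp Q (F ∙ v)) ⊔ F ∙ v) := by
    refine IsTotallySingular.sup_span (fun x hx => ρ.2.1 x (Submodule.mem_inf.1 hx).1) hv
      (mem_perp.2 fun w hw => ?_)
    rw [QuadraticMap.polar_comm]
    exact mem_perp_span_singleton.1 hw.2
  have hdim : Module.finrank F ((ρ.1 ⊓ perp Q (F ∙ v)) ⊔ F ∙ v : Submodule F V) = d := by
    rw [finrank_sup_span_singleton hvH, hH]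
  refine ⟨⟨_, hsing, fun U hU => (hQ.finrank_le hU).trans hdim.ge⟩, ⟨?_, ?_⟩, ?_⟩
  · refine le_antisymm (Nat.succ_le_of_lt (lt_of_le_of_ne (hQ.interDim_le _ _) fun he => ?_)) ?_
    · have := hQ.eq_of_interDim_eq he
      apply hvρ
      rw [this]
      exact Submodule.mem_sup_right (Submodule.mem_span_singleton_self v)
    · exact hH.ge.trans (Nat.succ_le_succ (Submodule.finrank_mono (le_inf inf_le_left le_sup_left)))
  · exact Submodule.mem_sup_right (Submodule.mem_span_singleton_self v)
  · rintro σ ⟨hσ, hvσ⟩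
    refine (hQ.generator_eq_of_le (sup_le ?_ ((Submodule.span_singleton_le_iff_mem _ _).2 hvσ))).symm
    have hle : ρ.1 ⊓ σ.1 ≤ ρ.1 ⊓ perp Q (F ∙ v) := fun x hx =>
      ⟨hx.1, mem_perp_span_singleton.2 (σ.2.1.polar_eq_zero hvσ hx.2)⟩
    rw [← Submodule.eq_of_le_of_finrank_le hle (by unfold interDim at hσ; omega)]
    exact inf_le_right

lemma IsHyperbolic.exists_singular_polar_ne_zero (hQ : IsHyperbolic Q d) {u : V} (hu : Q u = 0)
    (hu0 : u ≠ 0) : ∃ v, Q v = 0 ∧ QuadraticMap.polar Q u v ≠ 0 := by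
  obtain ⟨w, hw⟩ : ∃ w, QuadraticMap.polar Q u w ≠ 0 := by
    by_contra! hc
    have : u ∈ Q.polarBilin.ker := LinearMap.mem_ker.2 (LinearMap.ext hc)
    rw [hQ.ker_polarBilin] at this
    exact hu0 this
  have huu : QuadraticMap.polar Q u u = 0 := by simp [hu]
  refine ⟨w + (-(Q w) / QuadraticMap.polar Q u w) • u, ?_, ?_⟩
  · rw [QuadraticMap.map_add (⇑Q), QuadraticMap.map_smul, hu, QuadraticMap.polar_smul_right,
      QuadraticMap.polar_comm Q w u]
    simp [hw]
  · rw [QuadraticMap.polar_add_right, QuadraticMap.polar_smul_right, huu]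
    simpa using hw

/-- If `π` and `ρ` are not opposite, some neighbour of `ρ` is farther from `π`: the one through a
singular vector that is not orthogonal to `π ∩ ρ`. -/
lemma IsHyperbolic.exists_adj_interDim_succ (hQ : IsHyperbolic Q d) {π ρ : Generator Q}
    (h : interDim π ρ ≠ 0) :
    ∃ σ : Generator Q, interDim ρ σ + 1 = d ∧ interDim π ρ = interDim π σ + 1 := by
  obtain ⟨u, hu, hu0⟩ := Submodule.exists_mem_ne_zero_of_ne_bot
    (p := π.1 ⊓ ρ.1) fun hb => h (by unfold interDim; rw [hb, finrank_bot])
  obtain ⟨v, hv, huv⟩ := hQ.exists_singular_polar_ne_zero (π.2.1 u hu.1) hu0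
  obtain ⟨σ, ⟨hσ, hvσ⟩, -⟩ := hQ.existsUnique_adj ρ hv
    fun hvρ => huv (ρ.2.1.polar_eq_zero hu.2 hvρ)
  refine ⟨σ, hσ, ?_⟩
  rcases hQ.interDim_of_adj π hσ with h1 | h1
  · exact h1.2
  · exact absurd (σ.2.1.polar_eq_zero (h1.1 hu) hvσ) huv

lemma IsHyperbolic.exists_interDim_eq (hQ : IsHyperbolic Q d) (π : Generator Q) {i : ℕ}
    (hi : i ≤ d) : ∃ ρ : Generator Q, interDim π ρ + i = d := by
  induction i with
  | zero => exact ⟨π, hQ.interDim_self π⟩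
  | succ i ih =>
    obtain ⟨ρ, hρ⟩ := ih (by omega)
    obtain ⟨σ, -, h⟩ := hQ.exists_adj_interDim_succ (π := π) (ρ := ρ) (by omega)
    exact ⟨σ, by omega⟩

/-- If `π ≠ ρ`, some neighbour of `ρ` is closer to `π`: the one through a vector of `π` outside
`ρ`. -/
lemma IsHyperbolic.exists_adj_interDim_pred (hQ : IsHyperbolic Q d) {π ρ : Generator Q}
    (h : interDim π ρ ≠ d) :
    ∃ σ : Generator Q, interDim ρ σ + 1 = d ∧ interDim π σ = interDim π ρ + 1 := by
  obtain ⟨v, hvπ, hvρ⟩ : ∃ v ∈ π.1, v ∉ ρ.1 := SetLike.not_le_iff_exists.1 fun hle => h <| by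
    rw [hQ.generator_eq_of_le hle, hQ.interDim_self]
  obtain ⟨σ, ⟨hσ, hvσ⟩, -⟩ := hQ.existsUnique_adj ρ (π.2.1 v hvπ) hvρ
  refine ⟨σ, hσ, ?_⟩
  rcases hQ.interDim_of_adj π hσ with h1 | h1
  · exact absurd (h1.1 ⟨hvπ, hvσ⟩) hvρ
  · exact h1.2

/-- Adjacent generators have opposite parity with respect to any third one, hence the parity of
the distance is additive. -/
lemma IsHyperbolic.interDim_parity (hQ : IsHyperbolic Q d) (π₀ : Generator Q) {π ρ : Generator Q}
    {i : ℕ} (h : interDim π ρ + i = d) : interDim π₀ π + i ≡ interDim π₀ ρ [MOD 2] := by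
  induction i generalizing ρ with
  | zero => rw [hQ.eq_of_interDim_eq h]; rfl
  | succ i ih =>
    obtain ⟨σ, hσ, h1⟩ := hQ.exists_adj_interDim_pred (π := π) (ρ := ρ) (by omega)
    have h2 := ih (ρ := σ) (by omega)
    unfold Nat.ModEq at *
    rcases hQ.interDim_of_adj π₀ hσ with h3 | h3 <;> omega

open Classical in
lemma card_mem_not_mem [Fintype V] {A B : Submodule F V} (h : B ≤ A) :
    ((Finset.univ.filter fun v : V => v ∈ A ∧ v ∉ B).card : ℝ) =
      (Nat.card F : ℝ) ^ Module.finrank F A - (Nat.card F : ℝ) ^ Module.finrank F B := by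
  have key : ∀ C : Submodule F V, ((Finset.univ.filter fun v : V => v ∈ C).card : ℝ) =
      (Nat.card F : ℝ) ^ Module.finrank F C := by
    intro C
    rw [← Nat.cast_pow, ← Module.natCard_eq_pow_finrank (K := F) (V := C), Nat.card_eq_fintype_card,
      Fintype.card_subtype]
  rw [← key, ← key, eq_sub_iff_add_eq, ← Nat.cast_add, ← Finset.card_union_of_disjoint]
  · congr 2
    ext v
    have := @h v
    simp only [Finset.mem_union, Finset.mem_filter, Finset.mem_univ, true_and]
    tauto
  · rw [Finset.disjoint_filter]
    tauto

/-! ### Intersection numbers -/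

section Counting

variable [Finite F]

open Classical in
/-- The intersection number `c_i = (q^i - 1) / (q - 1)`: it counts the neighbours of `ρ` that are
closer to `π`, because each of them contains `q^(d-i+1) - q^(d-i)` of the `q^d - q^(d-i)` vectors
in `π \ ρ`, and each such vector lies in exactly one of them. -/
lemma IsHyperbolic.card_adj_closer (hQ : IsHyperbolic Q d) {π ρ : Generator Q} {i : ℕ}
    (h : interDim π ρ + i = d) :
    ((Finset.univ.filter fun σ : Generator Q =>
        interDim ρ σ + 1 = d ∧ interDim π σ = interDim π ρ + 1).card : ℝ) *
      ((Nat.card F : ℝ) - 1) = (Nat.card F : ℝ) ^ i - 1 := by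
  have : Finite V := Module.finite_of_finite F
  have := Fintype.ofFinite V
  have hq : (Nat.card F : ℝ) ≠ 0 := Nat.cast_ne_zero.2 Nat.card_pos.ne'
  set S := Finset.univ.filter fun σ : Generator Q =>
    interDim ρ σ + 1 = d ∧ interDim π σ = interDim π ρ + 1 with hS
  set T := Finset.univ.filter fun v : V => v ∈ π.1 ∧ v ∉ π.1 ⊓ ρ.1 with hT
  have hTc : (T.card : ℝ) = (Nat.card F : ℝ) ^ d - (Nat.card F : ℝ) ^ interDim π ρ := by
    rw [hT, card_mem_not_mem inf_le_left, hQ.finrank_generator]; rfl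
  have hdc := Finset.sum_card_bipartiteAbove_eq_sum_card_bipartiteBelow
    (s := S) (t := T) (fun (σ : Generator Q) (v : V) => v ∈ σ.1)
  have h1 : ∀ σ ∈ S, ((T.bipartiteAbove (fun (σ : Generator Q) (v : V) => v ∈ σ.1) σ).card : ℝ) =
      (Nat.card F : ℝ) ^ (interDim π ρ + 1) - (Nat.card F : ℝ) ^ interDim π ρ := by
    intro σ hσ
    obtain ⟨hadj, hcl⟩ := (Finset.mem_filter.1 hσ).2
    have hle : π.1 ⊓ ρ.1 ≤ σ.1 := by
      rcases hQ.interDim_of_adj π hadj with h1 | h1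
      · omega
      · exact h1.1
    rw [← hcl]
    change _ = (Nat.card F : ℝ) ^ Module.finrank F (π.1 ⊓ σ.1 : Submodule F V) -
      (Nat.card F : ℝ) ^ Module.finrank F (π.1 ⊓ ρ.1 : Submodule F V)
    rw [← card_mem_not_mem (le_inf inf_le_left hle)]
    congr 2
    ext v
    simp only [Finset.mem_bipartiteAbove, hT, Finset.mem_filter, Finset.mem_univ, true_and,
      Submodule.mem_inf]
    tauto
  have h2 : ∀ v ∈ T,
      (S.bipartiteBelow (fun (σ : Generator Q) (v : V) => v ∈ σ.1) v).card = 1 := by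
    intro v hv
    obtain ⟨hvπ, hvn⟩ := (Finset.mem_filter.1 hv).2
    have hvρ : v ∉ ρ.1 := fun hm => hvn ⟨hvπ, hm⟩
    obtain ⟨σ, ⟨hσ, hvσ⟩, huniq⟩ := hQ.existsUnique_adj ρ (π.2.1 v hvπ) hvρ
    refine Finset.card_eq_one.2 ⟨σ, ?_⟩
    ext τ
    simp only [Finset.mem_bipartiteBelow, hS, Finset.mem_filter, Finset.mem_univ, true_and,
      Finset.mem_singleton]
    constructor
    · rintro ⟨⟨hτ, -⟩, hvτ⟩
      exact huniq τ ⟨hτ, hvτ⟩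
    · rintro rfl
      refine ⟨⟨hσ, ?_⟩, hvσ⟩
      rcases hQ.interDim_of_adj π hσ with h1 | h1
      · exact absurd (h1.1 ⟨hvπ, hvσ⟩) hvρ
      · exact h1.2
  rw [Finset.sum_congr rfl h2, Finset.sum_const, smul_eq_mul, mul_one] at hdc
  have hdc' := congrArg (Nat.cast : ℕ → ℝ) hdc
  rw [Nat.cast_sum, Finset.sum_congr rfl h1, Finset.sum_const, nsmul_eq_mul, hTc] at hdc'
  have hpow : (Nat.card F : ℝ) ^ interDim π ρ ≠ 0 := pow_ne_zero _ hq
  apply mul_left_cancel₀ hpow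
  have : (Nat.card F : ℝ) ^ d = (Nat.card F : ℝ) ^ interDim π ρ * (Nat.card F : ℝ) ^ i := by
    rw [← pow_add, h]
  rw [this] at hdc'
  rw [pow_succ] at hdc'
  linear_combination hdc'

open Classical in
/-- The valency: all neighbours of `ρ` are closer to a generator opposite to `ρ`. -/
lemma IsHyperbolic.card_adj (hQ : IsHyperbolic Q d) (ρ : Generator Q) :
    ((Finset.univ.filter fun σ : Generator Q => interDim ρ σ + 1 = d).card : ℝ) *
      ((Nat.card F : ℝ) - 1) = (Nat.card F : ℝ) ^ d - 1 := by
  obtain ⟨π, hπ⟩ := hQ.exists_interDim_eq ρ le_rfl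
  rw [interDim_comm] at hπ
  rw [← hQ.card_adj_closer hπ]
  congr 3
  ext σ
  simp only [Finset.mem_filter, Finset.mem_univ, true_and]
  refine ⟨fun h => ⟨h, ?_⟩, And.left⟩
  rcases hQ.interDim_of_adj π h with h1 | h1 <;> omega

open Classical in
/-- The intersection number `b_i = (q^d - q^i) / (q - 1)`. -/
lemma IsHyperbolic.card_adj_farther (hQ : IsHyperbolic Q d) {π ρ : Generator Q} {i : ℕ}
    (h : interDim π ρ + i = d) :
    ((Finset.univ.filter fun σ : Generator Q =>
        interDim ρ σ + 1 = d ∧ interDim π ρ = interDim π σ + 1).card : ℝ) *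
      ((Nat.card F : ℝ) - 1) = (Nat.card F : ℝ) ^ d - (Nat.card F : ℝ) ^ i := by
  have h1 := hQ.card_adj_closer h
  have h2 := hQ.card_adj ρ
  have h3 : (Finset.univ.filter fun σ : Generator Q => interDim ρ σ + 1 = d).card =
      (Finset.univ.filter fun σ : Generator Q =>
        interDim ρ σ + 1 = d ∧ interDim π σ = interDim π ρ + 1).card +
      (Finset.univ.filter fun σ : Generator Q =>
        interDim ρ σ + 1 = d ∧ interDim π ρ = interDim π σ + 1).card := by
    rw [← Finset.card_union_of_disjoint]
    · congr 1
      ext σ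
      simp only [Finset.mem_union, Finset.mem_filter, Finset.mem_univ, true_and]
      refine ⟨fun hσ => ?_, fun hσ => by tauto⟩
      rcases hQ.interDim_of_adj π hσ with h1 | h1
      · exact Or.inr ⟨hσ, h1.2⟩
      · exact Or.inl ⟨hσ, h1.2⟩
    · rw [Finset.disjoint_filter]
      rintro σ - ⟨-, h1⟩ ⟨-, h2⟩
      omega
  rw [h3, Nat.cast_add] at h2
  linear_combination h2 - h1

end Counting

end Geometry

/-! ### Generating polynomials of the eigenvalues -/

section Eigenvalues

open Polynomial

/-- The polynomial `∏_{k < n} (1 + a q^k X)`, whose coefficients are Gaussian binomials. -/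
noncomputable def qPoly (q a : ℝ) (n : ℕ) : ℝ[X] :=
  ∏ k ∈ Finset.range n, (1 + C (a * q ^ k) * X)

lemma qPoly_comp (q a : ℝ) (n : ℕ) :
    (qPoly q a n).comp (C q * X) * (1 + C a * X) = qPoly q a n * (1 + C (a * q ^ n) * X) := by
  have h : (qPoly q a n).comp (C q * X) =
      ∏ k ∈ Finset.range n, (1 + C (a * q ^ (k + 1)) * X) := by
    rw [qPoly, Polynomial.prod_comp]
    refine Finset.prod_congr rfl fun k _ => ?_
    simp only [add_comp, one_comp, mul_comp, C_comp, X_comp, pow_succ, C_mul]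
    ring
  rw [h, qPoly, ← Finset.prod_range_succ, Finset.prod_range_succ', pow_zero, mul_one]

lemma natDegree_qPoly_le (q a : ℝ) (n : ℕ) : (qPoly q a n).natDegree ≤ n := by
  refine (natDegree_prod_le _ _).trans ?_
  refine (Finset.sum_le_card_nsmul _ _ 1 fun k _ => ?_).trans (by simp)
  compute_degree

lemma coeff_qPoly_zero (q a : ℝ) (n : ℕ) : (qPoly q a n).coeff 0 = 1 := by
  simp [qPoly, coeff_zero_eq_eval_zero, eval_prod]

lemma coeff_qPoly_succ (q a : ℝ) (n t : ℕ) :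
    (q ^ (t + 1) - 1) * (qPoly q a n).coeff (t + 1) = a * (q ^ n - q ^ t) * (qPoly q a n).coeff t := by
  have h := congrArg (fun p => p.coeff (t + 1)) (qPoly_comp q a n)
  simp only [mul_add, mul_one, coeff_add, ← mul_assoc, coeff_mul_X, coeff_mul_C,
    comp_C_mul_X_coeff] at h
  linear_combination h

lemma gaussBinom_succ (q n t : ℕ) :
    gaussBinom q n (t + 1) =
      gaussBinom q n t * (((q : ℝ) ^ (n - t) - 1) / ((q : ℝ) ^ (t + 1) - 1)) := by
  rw [gaussBinom, Finset.prod_range_succ]; rfl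

lemma gaussBinom_eq_zero {q n t : ℕ} (h : n < t) : gaussBinom q n t = 0 :=
  Finset.prod_eq_zero (Finset.mem_range.2 h) (by simp)

lemma pow_succ_sub_one_ne_zero {q : ℕ} (hq : 2 ≤ q) (t : ℕ) : (q : ℝ) ^ (t + 1) - 1 ≠ 0 := by
  have : (1 : ℝ) < q := by exact_mod_cast hq
  exact (sub_pos.2 (one_lt_pow₀ this t.succ_ne_zero)).ne'

/-- The `q`-binomial theorem. -/
lemma coeff_qPoly {q : ℕ} (hq : 2 ≤ q) (a : ℝ) (n t : ℕ) :
    (qPoly q a n).coeff t = a ^ t * gaussBinom q n t * (q : ℝ) ^ t.choose 2 := by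
  induction t with
  | zero => simp [coeff_qPoly_zero, gaussBinom]
  | succ t ih =>
    have h0 := pow_succ_sub_one_ne_zero hq t
    apply mul_left_cancel₀ h0
    rw [coeff_qPoly_succ, ih]
    rcases lt_or_ge n t with hlt | hle
    · rw [gaussBinom_eq_zero hlt, gaussBinom_eq_zero (hlt.trans t.lt_succ_self)]
      ring
    · rw [gaussBinom_succ, show (t + 1).choose 2 = t + t.choose 2 by
          rw [Nat.choose_succ_succ' t 1, Nat.choose_one_right], pow_add _ t (t.choose 2),
        show (q : ℝ) ^ n = (q : ℝ) ^ t * (q : ℝ) ^ (n - t) by rw [← pow_add]; congr 1; omega]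
      generalize (q : ℝ) ^ (t + 1) - 1 = D at h0 ⊢
      field_simp
      ring

lemma gaussBinom_mul_prod {q : ℕ} (hq : 2 ≤ q) {a b : ℕ} (h : b ≤ a) :
    gaussBinom q a b * ((∏ k ∈ Finset.range b, ((q : ℝ) ^ (k + 1) - 1)) *
      ∏ k ∈ Finset.range (a - b), ((q : ℝ) ^ (k + 1) - 1)) =
        ∏ k ∈ Finset.range a, ((q : ℝ) ^ (k + 1) - 1) := by
  induction b with
  | zero => simp [gaussBinom]
  | succ b ih =>
    rw [← ih (by omega), gaussBinom_succ, Finset.prod_range_succ,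
      show a - b = a - (b + 1) + 1 by omega, Finset.prod_range_succ]
    have h0 := pow_succ_sub_one_ne_zero hq b
    field_simp

lemma gaussBinom_symm {q : ℕ} (hq : 2 ≤ q) {a b : ℕ} (h : b ≤ a) :
    gaussBinom q a (a - b) = gaussBinom q a b := by
  have h1 := gaussBinom_mul_prod hq h
  have h2 := gaussBinom_mul_prod hq (Nat.sub_le a b)
  rw [Nat.sub_sub_self h] at h2
  have hne : ∀ m, ∏ k ∈ Finset.range m, ((q : ℝ) ^ (k + 1) - 1) ≠ 0 := fun m =>
    Finset.prod_ne_zero_iff.2 fun k _ => pow_succ_sub_one_ne_zero hq k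
  apply mul_right_cancel₀ (mul_ne_zero (hne b) (hne (a - b)))
  rw [h1, ← h2]
  ring

/-- Gaussian binomial coefficients are integers congruent to `1` modulo `q`. -/
lemma exists_gaussBinom_eq {q : ℕ} (hq : 2 ≤ q) {n t : ℕ} (h : t ≤ n) :
    ∃ z : ℤ, gaussBinom q n t = 1 + q * z := by
  induction n generalizing t with
  | zero => exact ⟨0, by simp [Nat.le_zero.1 h, gaussBinom]⟩
  | succ n ih =>
    cases t with
    | zero => exact ⟨0, by simp [gaussBinom]⟩
    | succ t =>
      have hq0 : (q : ℝ) ≠ 0 := by positivity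
      -- Pascal's rule, read off from `qPoly q 1 (n + 1) = qPoly q 1 n * (1 + q ^ n X)`.
      have hP : gaussBinom q (n + 1) (t + 1) =
          gaussBinom q n (t + 1) + (q : ℝ) ^ (n - t) * gaussBinom q n t := by
        have h1 : qPoly q 1 (n + 1) = qPoly q 1 n * (1 + C (1 * (q : ℝ) ^ n) * X) :=
          Finset.prod_range_succ _ _
        have h2 := congrArg (fun p => p.coeff (t + 1)) h1
        simp only [mul_add, mul_one, coeff_add, ← mul_assoc, coeff_mul_X, coeff_mul_C,
          coeff_qPoly hq, one_pow, one_mul] at h2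
        rw [Nat.choose_succ_succ' t 1, Nat.choose_one_right, pow_add,
          show (q : ℝ) ^ n = (q : ℝ) ^ t * (q : ℝ) ^ (n - t) by
            rw [← pow_add]; congr 1; omega] at h2
        have h3 : (q : ℝ) ^ t * (q : ℝ) ^ t.choose 2 ≠ 0 := by positivity
        apply mul_right_cancel₀ h3
        linear_combination h2
      obtain ⟨z, hz⟩ := ih (t := t) (by omega)
      rcases (Nat.le_of_succ_le_succ h).eq_or_lt with rfl | hlt
      · exact ⟨z, by rw [hP, gaussBinom_eq_zero t.lt_succ_self, hz]; simp⟩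
      · obtain ⟨w, hw⟩ := ih (t := t + 1) hlt
        refine ⟨w + q ^ (n - t - 1) * (1 + q * z), ?_⟩
        rw [hP, hz, hw, show n - t = n - t - 1 + 1 by omega, pow_succ]
        push_cast
        ring

/-- The generating polynomial of the eigenvalues `P_{j0}, …, P_{jd}`. -/
noncomputable def eigenPoly (q : ℝ) (d j : ℕ) : ℝ[X] := qPoly q (-1) j * qPoly q 1 (d - j)

lemma coeff_eigenPoly {q : ℕ} (hq : 2 ≤ q) (d j i : ℕ) :
    (eigenPoly q d j).coeff i = ∑ t ∈ Finset.range (i + 1),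
      (-1 : ℝ) ^ t * gaussBinom q j t * gaussBinom q (d - j) (i - t) *
        (q : ℝ) ^ (t.choose 2 + (i - t).choose 2) := by
  rw [eigenPoly, coeff_mul, Finset.Nat.sum_antidiagonal_eq_sum_range_succ_mk]
  refine Finset.sum_congr rfl fun t _ => ?_
  simp only [coeff_qPoly hq, one_pow, one_mul, pow_add]
  ring

lemma eigenP_eq_coeff {q d j i : ℕ} (hq : 2 ≤ q) (hj : j ≤ d) (hi : i ≤ d) :
    eigenP q d j i = (eigenPoly q d j).coeff i := by
  have hfilter : (eigenPoly q d j).coeff i =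
      ∑ t ∈ (Finset.range (i + 1)).filter (fun t => t ≤ j ∧ i - t ≤ d - j),
        (-1 : ℝ) ^ t * gaussBinom q j t * gaussBinom q (d - j) (i - t) *
          (q : ℝ) ^ (t.choose 2 + (i - t).choose 2) := by
    rw [coeff_eigenPoly hq]
    refine (Finset.sum_filter_of_ne fun t _ ht => ?_).symm
    refine ⟨not_lt.1 fun h => ht ?_, not_lt.1 fun h => ht ?_⟩ <;>
    · rw [gaussBinom_eq_zero h]
      ring
  rw [hfilter, eigenP]
  refine Finset.sum_bij' (fun s _ => j - s) (fun t _ => j - t) ?_ ?_ ?_ ?_ ?_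
  · intro s hs
    simp only [Finset.mem_Icc, Finset.mem_filter, Finset.mem_range] at hs ⊢
    omega
  · intro t ht
    simp only [Finset.mem_Icc, Finset.mem_filter, Finset.mem_range] at ht ⊢
    omega
  · intro s hs
    simp only [Finset.mem_Icc] at hs
    omega
  · intro t ht
    simp only [Finset.mem_filter, Finset.mem_range] at ht
    omega
  · intro s hs
    simp only [Finset.mem_Icc] at hs
    have e1 : (-1 : ℝ) ^ (j + s) = (-1) ^ (j - s) := by
      rw [show j + s = j - s + 2 * s by omega, pow_add, pow_mul]
      simp
    rw [e1, gaussBinom_symm hq (show s ≤ j by omega),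
      ← gaussBinom_symm hq (show d - i - s ≤ d - j by omega),
      show d - j - (d - i - s) = i - (j - s) by omega, show i + s - j = i - (j - s) by omega]

lemma eigenPoly_comp (q : ℝ) {d j : ℕ} (hj : j ≤ d) :
    (eigenPoly q d j).comp (C q * X) * (1 - X ^ 2) =
      eigenPoly q d j * (1 + C (q ^ (d - j) - q ^ j) * X - C (q ^ d) * X ^ 2) := by
  have h1 := qPoly_comp q (-1) j
  have h2 := qPoly_comp q 1 (d - j)
  have h3 : q ^ d = q ^ j * q ^ (d - j) := by rw [← pow_add]; congr 1; omega
  rw [h3]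
  simp only [eigenPoly, mul_comp, C_mul, C_neg, C_1, C_sub] at h1 h2 ⊢
  linear_combination (qPoly q 1 (d - j)).comp (C q * X) * (1 + 1 * X) * h1 +
    qPoly q (-1) j * (1 + -1 * C (q ^ j) * X) * h2

lemma coeff_eigenPoly_zero (q : ℝ) (d j : ℕ) : (eigenPoly q d j).coeff 0 = 1 := by
  simp [eigenPoly, mul_coeff_zero, coeff_qPoly_zero]

lemma coeff_eigenPoly_one (q : ℝ) {d j : ℕ} (hj : j ≤ d) :
    (q - 1) * (eigenPoly q d j).coeff 1 = q ^ (d - j) - q ^ j := by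
  have h := congrArg (fun p => p.coeff 1) (eigenPoly_comp q hj)
  simp only [mul_sub, mul_add, mul_one, coeff_sub, coeff_add, ← mul_assoc, coeff_mul_X_pow',
    coeff_mul_C, coeff_mul_X, comp_C_mul_X_coeff, coeff_eigenPoly_zero] at h
  norm_num at h
  linear_combination h

/-- The three-term recurrence of the eigenvalues, which is the `q`-difference equation
`eigenPoly_comp`. -/
lemma coeff_eigenPoly_add_two (q : ℝ) {d j : ℕ} (hj : j ≤ d) (i : ℕ) :
    (q ^ (i + 2) - 1) * (eigenPoly q d j).coeff (i + 2) +
      (q ^ d - q ^ i) * (eigenPoly q d j).coeff i =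
        (q ^ (d - j) - q ^ j) * (eigenPoly q d j).coeff (i + 1) := by
  have h := congrArg (fun p => p.coeff (i + 2)) (eigenPoly_comp q hj)
  simp only [mul_sub, mul_add, mul_one, coeff_sub, coeff_add, ← mul_assoc, coeff_mul_X_pow,
    coeff_mul_C, comp_C_mul_X_coeff] at h
  rw [show i + 2 = i + 1 + 1 from rfl, coeff_mul_X, coeff_mul_C] at h
  linear_combination h

lemma coeff_eigenPoly_eq_zero (q : ℝ) {d j i : ℕ} (hj : j ≤ d) (hi : d < i) :
    (eigenPoly q d j).coeff i = 0 := by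
  refine coeff_eq_zero_of_natDegree_lt (lt_of_le_of_lt natDegree_mul_le ?_)
  have h1 := natDegree_qPoly_le q (-1) j
  have h2 := natDegree_qPoly_le q 1 (d - j)
  omega

lemma qPoly_comp_neg (q a : ℝ) (n : ℕ) : (qPoly q a n).comp (C (-1) * X) = qPoly q (-a) n := by
  rw [qPoly, qPoly, Polynomial.prod_comp]
  refine Finset.prod_congr rfl fun k _ => ?_
  simp

lemma coeff_eigenPoly_sub (q : ℝ) {d j : ℕ} (hj : j ≤ d) (i : ℕ) :
    (eigenPoly q d (d - j)).coeff i = (-1) ^ i * (eigenPoly q d j).coeff i := by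
  rw [mul_comm, ← comp_C_mul_X_coeff, eigenPoly, eigenPoly, mul_comp, qPoly_comp_neg,
    qPoly_comp_neg, Nat.sub_sub_self hj, neg_neg, mul_comm]

lemma eigenP_sub {q d j i : ℕ} (hq : 2 ≤ q) (hj : j ≤ d) (hi : 2 * i ≤ d) :
    eigenP q d (d - j) (2 * i) = eigenP q d j (2 * i) := by
  rw [eigenP_eq_coeff hq hj hi, eigenP_eq_coeff hq (Nat.sub_le d j) hi, coeff_eigenPoly_sub _ hj,
    pow_mul]
  simp

lemma choose_two_add_choose_two {i t : ℕ} (ht : t ≤ 2 * i) :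
    ((t.choose 2 + (2 * i - t).choose 2 : ℕ) : ℤ) = i * (i - 1) + (i - t) ^ 2 := by
  have h : ((t.choose 2 + (2 * i - t).choose 2 : ℕ) : ℚ) = i * (i - 1) + (i - t) ^ 2 := by
    rw [Nat.cast_add, Nat.cast_choose_two, Nat.cast_choose_two, Nat.cast_sub ht]
    push_cast
    ring
  exact_mod_cast h

/-- The leading term of `P_{j,2i}` in the `q`-adic sense: in the alternating sum the exponent of
`q` is smallest for the unique admissible `t` that is nearest to `i`, namely `t = min i j`. -/
lemma eigenP_sub_mem_zmultiples {q d j i : ℕ} (hq : 2 ≤ q) (hj : 2 * j ≤ d) (hi : 2 * i ≤ d) :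
    eigenP q d j (2 * i) - (-1) ^ min i j *
      (q : ℝ) ^ ((min i j).choose 2 + (2 * i - min i j).choose 2) ∈
        AddSubgroup.zmultiples
          ((q : ℝ) ^ ((min i j).choose 2 + (2 * i - min i j).choose 2 + 1)) := by
  set m := min i j with hm
  set E := m.choose 2 + (2 * i - m).choose 2 with hE
  have hEm := choose_two_add_choose_two (show m ≤ 2 * i by omega)
  rw [eigenP_eq_coeff hq (by omega) hi, coeff_eigenPoly hq,
    ← Finset.add_sum_erase _ _ (Finset.mem_range.2 (show m < 2 * i + 1 by omega)),
    add_sub_right_comm]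
  refine AddSubgroup.add_mem _ ?_ (AddSubgroup.sum_mem _ fun t ht => ?_)
  · obtain ⟨z, hz⟩ := exists_gaussBinom_eq hq (show m ≤ j by omega)
    obtain ⟨w, hw⟩ := exists_gaussBinom_eq hq (show 2 * i - m ≤ d - j by omega)
    refine AddSubgroup.mem_zmultiples_iff.2 ⟨(-1) ^ m * (z + w + q * z * w), ?_⟩
    rw [hz, hw, ← hE, zsmul_eq_mul, pow_succ]
    push_cast
    ring
  · obtain ⟨htm, htr⟩ := Finset.mem_erase.1 ht
    have ht2 : t ≤ 2 * i := by have := Finset.mem_range.1 htr; omega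
    rcases lt_or_ge j t with htj | htj
    · rw [gaussBinom_eq_zero htj]
      simp
    rcases lt_or_ge (d - j) (2 * i - t) with htd | htd
    · rw [gaussBinom_eq_zero htd]
      simp
    obtain ⟨z, hz⟩ := exists_gaussBinom_eq hq htj
    obtain ⟨w, hw⟩ := exists_gaussBinom_eq hq htd
    have hlt : E < t.choose 2 + (2 * i - t).choose 2 := by
      have h1 := choose_two_add_choose_two ht2
      have h2 : ((i : ℤ) - m) ^ 2 < ((i : ℤ) - t) ^ 2 := by
        rw [sq_lt_sq, abs_of_nonneg (by omega), lt_abs]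
        omega
      zify
      push_cast at hEm h1 ⊢
      rw [hE]
      push_cast
      linarith
    obtain ⟨e, he⟩ := Nat.exists_eq_add_of_lt hlt
    refine AddSubgroup.mem_zmultiples_iff.2 ⟨(-1) ^ t * (1 + q * z) * (1 + q * w) * q ^ e, ?_⟩
    rw [hz, hw, he, zsmul_eq_mul]
    push_cast
    ring

lemma eigenP_ne_of_exponent_lt {q d j k i : ℕ} (hq : 2 ≤ q) (hj : 2 * j ≤ d) (hk : 2 * k ≤ d)
    (hi : 2 * i ≤ d)
    (hlt : (min i j).choose 2 + (2 * i - min i j).choose 2 <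
      (min i k).choose 2 + (2 * i - min i k).choose 2) :
    eigenP q d j (2 * i) ≠ eigenP q d k (2 * i) := by
  intro heq
  obtain ⟨z, hz⟩ := AddSubgroup.mem_zmultiples_iff.1 (eigenP_sub_mem_zmultiples hq hj hi)
  obtain ⟨w, hw⟩ := AddSubgroup.mem_zmultiples_iff.1 (eigenP_sub_mem_zmultiples hq hk hi)
  obtain ⟨e, he⟩ := Nat.exists_eq_add_of_lt hlt
  set E := (min i j).choose 2 + (2 * i - min i j).choose 2
  rw [heq] at hz
  rw [he] at hw
  simp only [zsmul_eq_mul] at hz hw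
  have hq0 : (q : ℝ) ^ E ≠ 0 := by positivity
  have h1 : (((-1) ^ min i j : ℤ) : ℝ) =
      ((q * ((-1) ^ min i k * q ^ e + w * q ^ (e + 1) - z) : ℤ) : ℝ) := by
    apply mul_left_cancel₀ hq0
    push_cast
    linear_combination hz - hw
  have h2 : (q : ℤ) ∣ (-1) ^ min i j := ⟨_, by exact_mod_cast h1⟩
  have h3 : (q : ℤ) ∣ 1 := by
    have := Int.isUnit_iff.2 (neg_one_pow_eq_or ℤ (min i j))
    exact h2.trans this.dvd
  have := Int.eq_one_of_dvd_one (by positivity) h3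
  omega

lemma pow_sub_pow_strictAnti {q : ℝ} (hq : 1 < q) {d j k : ℕ} (hjk : j < k) (hk : k ≤ d) :
    q ^ (d - k) - q ^ k < q ^ (d - j) - q ^ j := by
  have h1 : q ^ (d - k) < q ^ (d - j) := pow_lt_pow_right₀ hq (by omega)
  have h2 : q ^ j < q ^ k := pow_lt_pow_right₀ hq hjk
  linarith

/-- `P_{j2}` is a strictly increasing function of `P_{j1}^2`, and `P_{j1} ≥ 0` for `j ≤ d/2`. -/
lemma eigenP_two_injective {q d j k : ℕ} (hq : 2 ≤ q) (hd : 2 ≤ d) (hj : 2 * j ≤ d)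
    (hk : 2 * k ≤ d) (h : eigenP q d j 2 = eigenP q d k 2) : j = k := by
  have hq1 : (1 : ℝ) < q := by exact_mod_cast hq
  rw [eigenP_eq_coeff hq (by omega) hd, eigenP_eq_coeff hq (by omega) hd] at h
  have key : ∀ l, 2 * l ≤ d → 0 ≤ (q : ℝ) ^ (d - l) - (q : ℝ) ^ l ∧
      ((q : ℝ) ^ (d - l) - (q : ℝ) ^ l) ^ 2 =
        (q - 1) * ((q ^ 2 - 1) * (eigenPoly q d l).coeff 2 + (q ^ d - 1)) := by
    intro l hl
    refine ⟨sub_nonneg.2 (pow_le_pow_right₀ hq1.le (by omega)), ?_⟩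
    have h1 := coeff_eigenPoly_one (q : ℝ) (show l ≤ d by omega)
    have h2 := coeff_eigenPoly_add_two (q : ℝ) (show l ≤ d by omega) 0
    rw [coeff_eigenPoly_zero] at h2
    linear_combination (-(((q : ℝ) ^ (d - l) - (q : ℝ) ^ l))) * h1 - ((q : ℝ) - 1) * h2
  have hsq := (key j hj).2
  rw [h, ← (key k hk).2, sq_eq_sq₀ (key j hj).1 (key k hk).1] at hsq
  rcases lt_trichotomy j k with hlt | heq | hlt
  · exact absurd hsq (pow_sub_pow_strictAnti hq1 hlt (by omega)).ne'
  · exact heq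
  · exact absurd hsq (pow_sub_pow_strictAnti hq1 hlt (by omega)).ne

lemma eigenP_eq_eigenP_one_iff {q d j i : ℕ} (hq : 2 ≤ q) (hi : 1 ≤ i) (hid : 2 * i ≤ d)
    (hj : 2 * j ≤ d) : eigenP q d j (2 * i) = eigenP q d 1 (2 * i) ↔ j = 1 := by
  refine ⟨fun h => ?_, fun h => by rw [h]⟩
  rcases hi.eq_or_lt with rfl | hi2
  · exact eigenP_two_injective hq hid hj (by omega) h
  by_contra hj1
  have hm1 : min i 1 = 1 := min_eq_right hi
  have e1 := choose_two_add_choose_two (show 1 ≤ 2 * i by omega)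
  have ej := choose_two_add_choose_two (show min i j ≤ 2 * i by omega)
  rcases Nat.eq_zero_or_pos j with rfl | hj0
  · refine eigenP_ne_of_exponent_lt hq (by omega) hj hid ?_ h.symm
    rw [Nat.min_zero] at ej ⊢
    rw [hm1]
    zify at hi2 ⊢
    push_cast at e1 ej
    rw [e1, ej]
    nlinarith
  · refine eigenP_ne_of_exponent_lt hq hj (by omega) hid ?_ h
    have h2 : 2 ≤ min i j := by omega
    have h3 : min i j ≤ i := min_le_left _ _
    rw [hm1]
    generalize min i j = m at *
    zify at h2 h3 ⊢
    push_cast at e1 ej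
    rw [e1, ej]
    nlinarith

end Eigenvalues

/-! ### The relations between generators -/

section Relations

variable {F V : Type*} [Field F] [AddCommGroup V] [Module F V] {Q : QuadraticForm F V} {d : ℕ}

lemma relMatrix_eq_zero {i : ℕ} (hi : d < i) : relMatrix Q d i = 0 := by
  ext π ρ
  simp only [relMatrix, Matrix.of_apply, Matrix.zero_apply]
  exact if_neg (by omega)

lemma relMatrix_transpose (Q : QuadraticForm F V) (d i : ℕ) :
    (relMatrix Q d i).transpose = relMatrix Q d i := by
  ext π ρ
  simp [relMatrix, interDim_comm ρ π]

/-- Generators at even distance lie in the same class. -/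
lemma IsHyperbolic.relMatrix_eq_zero_of_class [FiniteDimensional F V] (hQ : IsHyperbolic Q d) {π₀ π ρ : Generator Q}
    (i : ℕ) (h : ¬(interDim π₀ π ≡ d [MOD 2] ↔ interDim π₀ ρ ≡ d [MOD 2])) :
    relMatrix Q d (2 * i) π ρ = 0 := by
  refine if_neg fun hi => h ?_
  have := hQ.interDim_parity π₀ hi
  unfold Nat.ModEq at *
  omega

end Relations

/-! ### Common eigenspaces of the relation matrices -/

section Scheme

open Polynomial

variable {F V : Type*} [Field F] [Finite F] [AddCommGroup V] [Module F V]
  [FiniteDimensional F V] {Q : QuadraticForm F V} {d : ℕ}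

lemma two_le_card (F : Type*) [Field F] [Finite F] : 2 ≤ Nat.card F := Finite.one_lt_card

/-- The three-term recurrence of the relation matrices, with the intersection numbers
`c_{i+2} = (q^(i+2) - 1) / (q - 1)` and `b_i = (q^d - q^i) / (q - 1)`. -/
lemma IsHyperbolic.relMatrix_one_mul (hQ : IsHyperbolic Q d) (i : ℕ) :
    ((Nat.card F : ℝ) - 1) • (relMatrix Q d 1 * relMatrix Q d (i + 1)) =
      ((Nat.card F : ℝ) ^ (i + 2) - 1) • relMatrix Q d (i + 2) +
        ((Nat.card F : ℝ) ^ d - (Nat.card F : ℝ) ^ i) • relMatrix Q d i := by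
  classical
  ext ρ π
  obtain ⟨k, hk⟩ : ∃ k, interDim π ρ + k = d :=
    ⟨_, Nat.add_sub_of_le (hQ.interDim_le π ρ)⟩
  have hsum : (relMatrix Q d 1 * relMatrix Q d (i + 1)) ρ π =
      ((Finset.univ.filter fun σ : Generator Q =>
        interDim ρ σ + 1 = d ∧ interDim π σ + (i + 1) = d).card : ℝ) := by
    rw [Matrix.mul_apply, Finset.card_filter, Nat.cast_sum]
    refine Finset.sum_congr rfl fun σ _ => ?_
    rw [interDim_comm π σ]
    by_cases h1 : interDim ρ σ + 1 = d <;> by_cases h2 : interDim σ π + (i + 1) = d <;>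
      simp [relMatrix, h1, h2]
  simp only [Matrix.smul_apply, Matrix.add_apply, smul_eq_mul, hsum]
  simp only [relMatrix, Matrix.of_apply, interDim_comm ρ π]
  by_cases h1 : k = i + 2
  · subst h1
    rw [if_pos hk, if_neg (by omega), ← hQ.card_adj_closer hk, mul_comm, mul_one, mul_zero,
      add_zero]
    congr 3
    ext σ
    simp only [Finset.mem_filter, Finset.mem_univ, true_and, and_congr_right_iff]
    omega
  by_cases h2 : k = i
  · subst h2
    rw [if_neg (by omega), if_pos hk, ← hQ.card_adj_farther hk, mul_comm, mul_one, mul_zero,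
      zero_add]
    congr 3
    ext σ
    simp only [Finset.mem_filter, Finset.mem_univ, true_and, and_congr_right_iff]
    omega
  rw [if_neg (by omega), if_neg (by omega), Finset.card_eq_zero.2]
  · simp
  · refine Finset.filter_eq_empty_iff.2 fun σ _ ⟨hσ, hd⟩ => ?_
    rcases hQ.interDim_of_adj π hσ with h3 | h3 <;> omega

lemma IsHyperbolic.relMatrix_zero_mulVecLin (hQ : IsHyperbolic Q d) :
    (relMatrix Q d 0).mulVecLin = 1 := by
  refine LinearMap.ext fun v => funext fun π => ?_
  rw [Matrix.mulVecLin_apply, Matrix.mulVec, dotProduct, Finset.sum_eq_single π]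
  · simp [relMatrix, hQ.interDim_self]
  · intro ρ _ hρ
    have : interDim π ρ ≠ d := fun h => hρ (hQ.eq_of_interDim_eq h).symm
    simp [relMatrix, this]
  · simp

/-- The polynomials `p_i` with `A_i = p_i(A_1)`. -/
noncomputable def relPoly (q : ℝ) (d : ℕ) : ℕ → ℝ[X]
  | 0 => 1
  | 1 => X
  | i + 2 => C (q ^ (i + 2) - 1)⁻¹ *
      (C (q - 1) * X * relPoly q d (i + 1) - C (q ^ d - q ^ i) * relPoly q d i)

lemma natDegree_relPoly_le_and_coeff_ne_zero {q : ℕ} (hq : 2 ≤ q) (d i : ℕ) :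
    (relPoly q d i).natDegree ≤ i ∧ (relPoly q d i).coeff i ≠ 0 := by
  induction i using Nat.twoStepInduction with
  | zero => simp [relPoly]
  | one => simp [relPoly]
  | more i ih1 ih2 =>
    have hq1 : (q : ℝ) - 1 ≠ 0 := by simpa using pow_succ_sub_one_ne_zero hq 0
    constructor
    · rw [relPoly]
      refine (natDegree_C_mul_le _ _).trans ((natDegree_sub_le _ _).trans (max_le ?_ ?_))
      · rw [mul_assoc]
        refine (natDegree_C_mul_le _ _).trans (natDegree_mul_le.trans ?_)
        rw [natDegree_X]
        omega
      · exact (natDegree_C_mul_le _ _).trans (by omega)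
    · have h0 : (relPoly q d i).coeff (i + 2) = 0 :=
        coeff_eq_zero_of_natDegree_lt (by omega)
      rw [relPoly, coeff_C_mul, coeff_sub, coeff_C_mul, h0, mul_zero, sub_zero, mul_assoc,
        coeff_C_mul, show i + 2 = i + 1 + 1 from rfl, coeff_X_mul]
      exact mul_ne_zero (inv_ne_zero (pow_succ_sub_one_ne_zero hq _)) (mul_ne_zero hq1 ih2.2)

lemma mulVecLin_smul {m n : Type*} [Fintype n] (c : ℝ) (M : Matrix m n ℝ) :
    (c • M).mulVecLin = c • M.mulVecLin :=
  LinearMap.ext fun v => Matrix.smul_mulVec c M v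

lemma IsHyperbolic.aeval_relPoly (hQ : IsHyperbolic Q d) (i : ℕ) :
    aeval (relMatrix Q d 1).mulVecLin (relPoly (Nat.card F) d i) =
      (relMatrix Q d i).mulVecLin := by
  induction i using Nat.twoStepInduction with
  | zero => rw [relPoly, map_one, hQ.relMatrix_zero_mulVecLin]
  | one => rw [relPoly, aeval_X]
  | more i ih1 ih2 =>
    have h0 := pow_succ_sub_one_ne_zero (two_le_card F) (i + 1)
    have h := congrArg Matrix.mulVecLin (hQ.relMatrix_one_mul i)
    simp only [mulVecLin_smul, Matrix.mulVecLin_add, Matrix.mulVecLin_mul] at h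
    rw [relPoly, map_mul, map_sub, map_mul, map_mul, map_mul, aeval_X, ih1, ih2, aeval_C, aeval_C,
      aeval_C, mul_assoc]
    rw [← Algebra.smul_def, ← Algebra.smul_def, ← Algebra.smul_def, Module.End.mul_eq_comp, h,
      add_sub_cancel_right, smul_smul, inv_mul_cancel₀ h0, one_smul]

/-- The eigenvalue `P_{j1}`, given by its closed form. -/
noncomputable def theta (q : ℝ) (d j : ℕ) : ℝ := (q ^ (d - j) - q ^ j) / (q - 1)

lemma eval_relPoly {q d j : ℕ} (hq : 2 ≤ q) (hj : j ≤ d) (i : ℕ) :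
    (relPoly q d i).eval (theta q d j) = (eigenPoly q d j).coeff i := by
  have hq1 : (q : ℝ) - 1 ≠ 0 := by simpa using pow_succ_sub_one_ne_zero hq 0
  induction i using Nat.twoStepInduction with
  | zero => simp [relPoly, coeff_eigenPoly_zero]
  | one =>
    rw [relPoly, eval_X, theta, ← coeff_eigenPoly_one (q : ℝ) hj]
    field_simp
  | more i ih1 ih2 =>
    have h0 := pow_succ_sub_one_ne_zero hq (i + 1)
    have h := coeff_eigenPoly_add_two (q : ℝ) hj i
    simp only [relPoly, eval_mul, eval_sub, eval_C, eval_X, ih1, ih2]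
    rw [theta, mul_div_cancel₀ _ hq1, ← h, add_sub_cancel_right, ← mul_assoc,
      inv_mul_cancel₀ h0, one_mul]

lemma theta_injOn {q : ℕ} (hq : 2 ≤ q) (d : ℕ) :
    Set.InjOn (theta q d) (Finset.range (d + 1)) := by
  have hq1 : (1 : ℝ) < q := by exact_mod_cast hq
  have key : ∀ j k, j < k → k ≤ d → theta q d k < theta q d j := fun j k hjk hk =>
    div_lt_div_of_pos_right (pow_sub_pow_strictAnti hq1 hjk hk) (sub_pos.2 hq1)
  intro j hj k hk h
  simp only [Finset.coe_range, Set.mem_Iio] at hj hk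
  rcases lt_trichotomy j k with hlt | heq | hlt
  · exact absurd h (key j k hlt (by omega)).ne'
  · exact heq
  · exact absurd h (key k j hlt (by omega)).ne

lemma relPoly_succ_eq {q : ℕ} (hq : 2 ≤ q) (d : ℕ) :
    relPoly q d (d + 1) = C ((relPoly q d (d + 1)).coeff (d + 1)) *
      Lagrange.nodal (Finset.range (d + 1)) (theta q d) := by
  set N := Lagrange.nodal (Finset.range (d + 1)) (theta q d) with hN
  have hNd : N.natDegree = d + 1 := by simp [hN]
  refine Polynomial.eq_of_degree_sub_lt_of_eval_index_eq _ (theta_injOn hq d) ?_ ?_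
  · rw [Finset.card_range, degree_lt_iff_coeff_zero]
    intro m hm
    rw [coeff_sub, coeff_C_mul]
    rcases hm.eq_or_lt with rfl | hlt
    · have : N.coeff (d + 1) = 1 := by
        rw [← hNd]; exact Lagrange.nodal_monic.coeff_natDegree
      rw [this, mul_one, sub_self]
    · rw [coeff_eq_zero_of_natDegree_lt (hNd.trans_lt hlt), coeff_eq_zero_of_natDegree_lt
        ((natDegree_relPoly_le_and_coeff_ne_zero hq d (d + 1)).1.trans_lt hlt)]
      simp
  · intro j hj
    rw [eval_mul, Lagrange.eval_nodal_at_node hj, mul_zero,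
      eval_relPoly hq (by have := Finset.mem_range.1 hj; omega),
      coeff_eigenPoly_eq_zero _ (by have := Finset.mem_range.1 hj; omega) d.lt_succ_self]

/-- The matrix `A_1` is annihilated by `∏_{j ≤ d} (X - P_{j1})`, a multiple of `p_{d+1}`. -/
lemma IsHyperbolic.aeval_nodal (hQ : IsHyperbolic Q d) :
    aeval (relMatrix Q d 1).mulVecLin
      (Lagrange.nodal (Finset.range (d + 1)) (theta (Nat.card F) d)) = 0 := by
  have h := hQ.aeval_relPoly (d + 1)
  rw [relPoly_succ_eq (two_le_card F), relMatrix_eq_zero d.lt_succ_self, map_mul, aeval_C,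
    ← Algebra.smul_def, Matrix.mulVecLin_zero] at h
  exact (smul_eq_zero.1 h).resolve_left
    (natDegree_relPoly_le_and_coeff_ne_zero (two_le_card F) d (d + 1)).2

lemma mulVecLin_of_mem_schemeSpace {j i : ℕ} (hi : i ≤ d) {v : Generator Q → ℝ}
    (hv : v ∈ schemeSpace Q d j) :
    (relMatrix Q d i).mulVecLin v = eigenP (Nat.card F) d j i • v := by
  simp only [schemeSpace, Submodule.mem_iInf] at hv
  exact Module.End.mem_eigenspace_iff.1 (hv i (Finset.mem_range.2 (by omega)))

lemma IsHyperbolic.eigenspace_le_schemeSpace (hQ : IsHyperbolic Q d) {j : ℕ} (hj : j ≤ d) :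
    Module.End.eigenspace (relMatrix Q d 1).mulVecLin (theta (Nat.card F) d j) ≤
      schemeSpace Q d j := by
  intro v hv
  simp only [schemeSpace, Submodule.mem_iInf]
  intro i hi
  rw [Module.End.mem_eigenspace_iff]
  rcases eq_or_ne v 0 with rfl | hv0
  · simp
  rw [← hQ.aeval_relPoly, Module.End.aeval_apply_of_hasEigenvector ⟨hv, hv0⟩,
    eval_relPoly (two_le_card F) hj,
    eigenP_eq_coeff (two_le_card F) hj (by have := Finset.mem_range.1 hi; omega)]

lemma IsHyperbolic.aeval_nodal_erase_mem (hQ : IsHyperbolic Q d) {j : ℕ} (hj : j ≤ d)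
    (v : Generator Q → ℝ) :
    aeval (relMatrix Q d 1).mulVecLin
      (Lagrange.nodal ((Finset.range (d + 1)).erase j) (theta (Nat.card F) d)) v ∈
        schemeSpace Q d j := by
  refine hQ.eigenspace_le_schemeSpace hj (Module.End.mem_eigenspace_iff.2 ?_)
  have h := hQ.aeval_nodal
  rw [Lagrange.nodal_eq_mul_nodal_erase (Finset.mem_range.2 (Nat.lt_succ_of_le hj)), map_mul,
    map_sub, aeval_X, aeval_C] at h
  have h2 := LinearMap.congr_fun h v
  rw [Module.End.mul_apply, LinearMap.sub_apply, Module.algebraMap_end_apply, LinearMap.zero_apply,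
    sub_eq_zero] at h2
  exact h2

/-- Lagrange interpolation at the nodes `P_{j1}` decomposes each vector. -/
lemma IsHyperbolic.exists_decomposition (hQ : IsHyperbolic Q d) (v : Generator Q → ℝ) :
    ∃ x : ℕ → Generator Q → ℝ, (∀ j ≤ d, x j ∈ schemeSpace Q d j) ∧
      ∑ j ∈ Finset.range (d + 1), x j = v := by
  refine ⟨fun j => aeval (relMatrix Q d 1).mulVecLin
    (Lagrange.basis (Finset.range (d + 1)) (theta (Nat.card F) d) j) v, fun j hj => ?_, ?_⟩
  · have hmem := Finset.mem_range.2 (Nat.lt_succ_of_le hj)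
    simp only
    rw [Lagrange.basis_eq_prod_sub_inv_mul_nodal_div hmem, ← Lagrange.nodal_erase_eq_nodal_div hmem,
      map_mul, aeval_C, Module.End.mul_apply, Module.algebraMap_end_apply]
    exact Submodule.smul_mem _ _ (hQ.aeval_nodal_erase_mem hj v)
  · have h := Lagrange.sum_basis (theta_injOn (two_le_card F) d) ⟨0, Finset.mem_range.2 d.succ_pos⟩
    rw [← LinearMap.sum_apply, ← map_sum, h, map_one, Module.End.one_apply]

lemma IsHyperbolic.schemeSpace_orthogonal {j k : ℕ} (hj : j ≤ d) (hk : k ≤ d)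
    (hjk : j ≠ k) {u w : Generator Q → ℝ} (hu : u ∈ schemeSpace Q d j)
    (hw : w ∈ schemeSpace Q d k) : u ⬝ᵥ w = 0 := by
  have hq := two_le_card F
  have hu1 := mulVecLin_of_mem_schemeSpace (show 1 ≤ d by omega) hu
  have hw1 := mulVecLin_of_mem_schemeSpace (show 1 ≤ d by omega) hw
  have heig : ∀ l ≤ d, eigenP (Nat.card F) d l 1 = theta (Nat.card F) d l := fun l hl => by
    rw [eigenP_eq_coeff hq hl (by omega), ← eval_relPoly hq hl, relPoly, eval_X]
  rw [heig j hj, Matrix.mulVecLin_apply] at hu1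
  rw [heig k hk, Matrix.mulVecLin_apply] at hw1
  have h : (relMatrix Q d 1).mulVec u ⬝ᵥ w = u ⬝ᵥ (relMatrix Q d 1).mulVec w := by
    rw [Matrix.dotProduct_mulVec, ← Matrix.mulVec_transpose, relMatrix_transpose]
  rw [hu1, hw1, smul_dotProduct, dotProduct_smul, smul_eq_mul, smul_eq_mul] at h
  by_contra hne
  refine hjk (theta_injOn hq d ?_ ?_ (mul_right_cancel₀ hne h)) <;> simp <;> omega

open Classical in
/-- The number of walks of length `k` from `π` to `ρ` vanishes if `k` is less than the distance,
and does not vanish if `k` is equal to it. -/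
lemma IsHyperbolic.walk_count (hQ : IsHyperbolic Q d) (π : Generator Q) (k : ℕ) :
    (∀ ρ, 0 ≤ ((relMatrix Q d 1).mulVecLin ^ k) (Pi.single π (1 : ℝ)) ρ) ∧
    (∀ ρ, interDim π ρ + k < d →
      ((relMatrix Q d 1).mulVecLin ^ k) (Pi.single π (1 : ℝ)) ρ = 0) ∧
    (∀ ρ, interDim π ρ + k = d →
      0 < ((relMatrix Q d 1).mulVecLin ^ k) (Pi.single π (1 : ℝ)) ρ) := by
  induction k with
  | zero =>
    refine ⟨fun ρ => ?_, fun ρ hρ => ?_, fun ρ hρ => ?_⟩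
    · by_cases h : ρ = π <;> simp [h]
    · have : ρ ≠ π := by
        rintro rfl
        rw [hQ.interDim_self] at hρ
        omega
      simp [this]
    · rw [hQ.eq_of_interDim_eq hρ]
      simp
  | succ k ih =>
    obtain ⟨ih0, ih1, ih2⟩ := ih
    have hstep : ∀ ρ, ((relMatrix Q d 1).mulVecLin ^ (k + 1)) (Pi.single π (1 : ℝ)) ρ =
        ∑ σ, (if interDim ρ σ + 1 = d then 1 else 0) *
          ((relMatrix Q d 1).mulVecLin ^ k) (Pi.single π (1 : ℝ)) σ := by
      intro ρ
      rw [pow_succ', Module.End.mul_apply]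
      rfl
    have hnn : ∀ ρ σ, 0 ≤ (if interDim ρ σ + 1 = d then (1 : ℝ) else 0) *
        ((relMatrix Q d 1).mulVecLin ^ k) (Pi.single π (1 : ℝ)) σ := fun ρ σ =>
      mul_nonneg (by split_ifs <;> norm_num) (ih0 σ)
    refine ⟨fun ρ => ?_, fun ρ hρ => ?_, fun ρ hρ => ?_⟩
    · rw [hstep]
      exact Finset.sum_nonneg fun σ _ => hnn ρ σ
    · rw [hstep]
      refine Finset.sum_eq_zero fun σ _ => ?_
      split_ifs with hσ
      · rw [one_mul]
        apply ih1
        rcases hQ.interDim_of_adj π hσ with h | h <;> omega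
      · rw [zero_mul]
    · rw [hstep]
      obtain ⟨σ, hσ, h⟩ := hQ.exists_adj_interDim_pred (π := π) (ρ := ρ) (by omega)
      refine Finset.sum_pos' (fun σ _ => hnn ρ σ) ⟨σ, Finset.mem_univ σ, ?_⟩
      rw [if_pos hσ, one_mul]
      exact ih2 σ (by omega)

/-- Each `V_j` contains a vector that does not vanish at `ρ`, for `ρ` opposite to some `π`: the
image of the unit vector at `π` under a monic polynomial of degree `d` in `A_1`, of which only
the leading term contributes at `ρ`. -/
lemma IsHyperbolic.exists_mem_schemeSpace_ne_zero (hQ : IsHyperbolic Q d) {j : ℕ} (hj : j ≤ d)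
    {π ρ : Generator Q} (h : interDim π ρ = 0) : ∃ v ∈ schemeSpace Q d j, v ρ ≠ 0 := by
  classical
  refine ⟨_, hQ.aeval_nodal_erase_mem hj (Pi.single π 1), ?_⟩
  set N := Lagrange.nodal ((Finset.range (d + 1)).erase j) (theta (Nat.card F) d) with hN
  have hNd : N.natDegree = d := by
    rw [hN, Lagrange.natDegree_nodal, Finset.card_erase_of_mem (Finset.mem_range.2 (by omega)),
      Finset.card_range, Nat.add_sub_cancel]
  have hlead : N.coeff d = 1 := by
    rw [show N.coeff d = N.leadingCoeff by rw [leadingCoeff, hNd]]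
    exact Lagrange.nodal_monic
  rw [aeval_eq_sum_range, hNd, Finset.sum_range_succ, LinearMap.add_apply, LinearMap.sum_apply,
    Pi.add_apply, Finset.sum_apply, Finset.sum_eq_zero, zero_add, hlead, one_smul]
  · exact ((hQ.walk_count π d).2.2 ρ (by omega)).ne'
  · intro k hk
    have := (hQ.walk_count π k).2.1 ρ (by have := Finset.mem_range.1 hk; omega)
    rw [LinearMap.smul_apply, Pi.smul_apply, this, smul_zero]

end Scheme

/-! ### One class of generators -/

section Class

variable {F V : Type*} [Field F] [Finite F] [AddCommGroup V] [Module F V]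
  [FiniteDimensional F V] {Q : QuadraticForm F V} {d : ℕ}

/-- The coordinate restriction to the class of `π₀`. -/
def restrictClass (Q : QuadraticForm F V) (d : ℕ) (π₀ : Generator Q) :
    (Generator Q → ℝ) →ₗ[ℝ] (GenClass Q d π₀ → ℝ) :=
  LinearMap.funLeft ℝ ℝ fun π : GenClass Q d π₀ => π.1

lemma classSpace_eq_map (Q : QuadraticForm F V) (d : ℕ) (π₀ : Generator Q) (j : ℕ) :
    classSpace Q d π₀ j =
      (schemeSpace Q d j ⊔ schemeSpace Q d (d - j)).map (restrictClass Q d π₀) := rfl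

lemma IsHyperbolic.classMatrix_mulVec (hQ : IsHyperbolic Q d) (π₀ : Generator Q) (i : ℕ)
    (v : Generator Q → ℝ) (π : GenClass Q d π₀) :
    (classMatrix Q d π₀ i).mulVec (fun ρ => v ρ.1) π = (relMatrix Q d (2 * i)).mulVec v π.1 := by
  refine Fintype.sum_of_injective (fun ρ : GenClass Q d π₀ => ρ.1) Subtype.val_injective
    (fun ρ => relMatrix Q d (2 * i) π.1 ρ.1 * v ρ.1)
    (fun ρ => relMatrix Q d (2 * i) π.1 ρ * v ρ) (fun ρ hρ => ?_) fun ρ => rfl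
  rw [hQ.relMatrix_eq_zero_of_class (π₀ := π₀), zero_mul]
  exact fun h => hρ ⟨⟨ρ, h.1 π.2⟩, rfl⟩

lemma IsHyperbolic.classSpace_le_eigenspace (hQ : IsHyperbolic Q d) (π₀ : Generator Q)
    {i j : ℕ} (hi : 2 * i ≤ d) (hj : j ≤ d) :
    classSpace Q d π₀ j ≤ Module.End.eigenspace (classMatrix Q d π₀ i).mulVecLin
      (eigenP (Nat.card F) d j (2 * i)) := by
  have key : ∀ v, (relMatrix Q d (2 * i)).mulVecLin v = eigenP (Nat.card F) d j (2 * i) • v →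
      restrictClass Q d π₀ v ∈
        Module.End.eigenspace (classMatrix Q d π₀ i).mulVecLin
          (eigenP (Nat.card F) d j (2 * i)) := by
    intro v hv
    refine Module.End.mem_eigenspace_iff.2 (funext fun π => ?_)
    exact (hQ.classMatrix_mulVec π₀ i v π).trans (congrFun hv π.1)
  rw [classSpace_eq_map, Submodule.map_sup, sup_le_iff, Submodule.map_le_iff_le_comap,
    Submodule.map_le_iff_le_comap]
  refine ⟨fun v hv => key v (mulVecLin_of_mem_schemeSpace hi hv), fun v hv => key v ?_⟩
  rw [← eigenP_sub (two_le_card F) hj hi]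
  exact mulVecLin_of_mem_schemeSpace hi hv

lemma IsHyperbolic.classSpace_ne_bot (hQ : IsHyperbolic Q d) (hd : Even d) (π₀ : Generator Q)
    {j : ℕ} (hj : j ≤ d) : classSpace Q d π₀ j ≠ ⊥ := by
  obtain ⟨ρ, hρ⟩ := hQ.exists_interDim_eq π₀ le_rfl
  have hρ0 : interDim π₀ ρ = 0 := by omega
  obtain ⟨v, hv, hvρ⟩ := hQ.exists_mem_schemeSpace_ne_zero hj hρ0
  have hclass : interDim π₀ ρ ≡ d [MOD 2] := by
    rw [hρ0]
    exact (Nat.even_iff.1 hd).symm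
  refine fun hbot => hvρ ?_
  have hmem : restrictClass Q d π₀ v ∈
      classSpace Q d π₀ j := Submodule.mem_map_of_mem (Submodule.mem_sup_left hv)
  rw [hbot, Submodule.mem_bot] at hmem
  exact congrFun hmem ⟨ρ, hclass⟩

/-- In the decomposition of an eigenvector of `A_i`, only those `V_j` contribute that belong to
the eigenvalue. -/
lemma IsHyperbolic.mem_of_eigenvector (hQ : IsHyperbolic Q d) {i : ℕ} (hi : i ≤ d) {μ : ℝ}
    {v : Generator Q → ℝ} (hv : (relMatrix Q d i).mulVecLin v = μ • v)
    {W : Submodule ℝ (Generator Q → ℝ)}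
    (hW : ∀ j ≤ d, eigenP (Nat.card F) d j i = μ → schemeSpace Q d j ≤ W) : v ∈ W := by
  obtain ⟨x, hx, rfl⟩ := hQ.exists_decomposition v
  refine Submodule.sum_mem _ fun j hj => ?_
  have hjd : j ≤ d := Nat.lt_succ_iff.1 (Finset.mem_range.1 hj)
  by_cases heq : eigenP (Nat.card F) d j i = μ
  · exact hW j hjd heq (hx j hjd)
  rw [map_sum, Finset.smul_sum, ← sub_eq_zero, ← Finset.sum_sub_distrib] at hv
  have h := congrArg (fun y => x j ⬝ᵥ y) hv
  simp only [dotProduct_zero] at h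
  rw [dotProduct_sum, Finset.sum_eq_single j] at h
  · rw [mulVecLin_of_mem_schemeSpace hi (hx j hjd), ← sub_smul, dotProduct_smul, smul_eq_mul,
      mul_eq_zero, dotProduct_self_eq_zero] at h
    rw [h.resolve_left (sub_ne_zero.2 heq)]
    exact W.zero_mem
  · intro k hk hkj
    have hkd : k ≤ d := Nat.lt_succ_iff.1 (Finset.mem_range.1 hk)
    rw [mulVecLin_of_mem_schemeSpace hi (hx k hkd), ← sub_smul, dotProduct_smul,
      IsHyperbolic.schemeSpace_orthogonal hjd hkd hkj.symm (hx j hjd) (hx k hkd), smul_zero]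
  · exact fun hn => absurd hj hn

lemma IsHyperbolic.eigenspace_le_classSpace_one (hQ : IsHyperbolic Q d) (π₀ : Generator Q)
    {i : ℕ} (hi : 1 ≤ i) (hid : 2 * i ≤ d) :
    Module.End.eigenspace (classMatrix Q d π₀ i).mulVecLin
      (eigenP (Nat.card F) d 1 (2 * i)) ≤ classSpace Q d π₀ 1 := by
  classical
  intro w hw
  rw [Module.End.mem_eigenspace_iff] at hw
  -- The extension of `w` by zero is an eigenvector of `A_{2i}`.
  set v : Generator Q → ℝ :=
    fun π => if h : interDim π₀ π ≡ d [MOD 2] then w ⟨π, h⟩ else 0 with hv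
  have hvw : (fun ρ : GenClass Q d π₀ => v ρ.1) = w := funext fun ρ => dif_pos ρ.2
  have heig : (relMatrix Q d (2 * i)).mulVecLin v = eigenP (Nat.card F) d 1 (2 * i) • v := by
    funext π
    by_cases h : interDim π₀ π ≡ d [MOD 2]
    · have h1 := hQ.classMatrix_mulVec π₀ i v ⟨π, h⟩
      rw [hvw] at h1
      refine h1.symm.trans ((congrFun hw ⟨π, h⟩).trans ?_)
      rw [Pi.smul_apply, show v π = w ⟨π, h⟩ from dif_pos h]
      rfl
    · have hvπ : v π = 0 := dif_neg h
      rw [Pi.smul_apply, hvπ, smul_zero]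
      refine Finset.sum_eq_zero fun ρ _ => ?_
      by_cases hρ : interDim π₀ ρ ≡ d [MOD 2]
      · change relMatrix Q d (2 * i) π ρ * v ρ = 0
        rw [hQ.relMatrix_eq_zero_of_class (π₀ := π₀) i (by tauto), zero_mul]
      · rw [show v ρ = 0 from dif_neg hρ, mul_zero]
  refine ⟨v, hQ.mem_of_eigenvector hid heig fun j hj hP => ?_, hvw⟩
  rcases le_or_gt (2 * j) d with h | h
  · rw [(eigenP_eq_eigenP_one_iff (two_le_card F) hi hid h).1 hP]
    exact le_sup_left
  · rw [← eigenP_sub (two_le_card F) hj hid] at hP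
    have := (eigenP_eq_eigenP_one_iff (two_le_card F) hi hid (by omega)).1 hP
    rw [show j = d - 1 by omega]
    exact le_sup_right

end Class

end HyperbolicQuadric

theorem mainTheorem7 {F V : Type*} [Field F] [Finite F] [AddCommGroup V] [Module F V]
    [FiniteDimensional F V] (Q : QuadraticForm F V) (d : ℕ) (hd : Even d)
    (hQ : HyperbolicQuadric.IsHyperbolic Q d) (π₀ : HyperbolicQuadric.Generator Q) :
    -- `ℝ^Ω` is the orthogonal sum of `V_0, …, V_d`
    ((∀ j ≤ d, ∀ k ≤ d, j ≠ k →
        ∀ u ∈ HyperbolicQuadric.schemeSpace Q d j, ∀ w ∈ HyperbolicQuadric.schemeSpace Q d k,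
          u ⬝ᵥ w = 0) ∧
      ⨆ j ∈ Finset.range (d + 1), HyperbolicQuadric.schemeSpace Q d j = ⊤) ∧
    ∀ i : ℕ, 1 ≤ i → 2 * i ≤ d →
      -- among the eigenvalues of `A'_i` on `V'_0, …, V'_{d/2}`, only the one on `V'_1` is `P_{1,2i}`
      (∀ j ≤ d / 2,
        HyperbolicQuadric.classSpace Q d π₀ j ≠ ⊥ ∧
        HyperbolicQuadric.classSpace Q d π₀ j ≤
          Module.End.eigenspace (HyperbolicQuadric.classMatrix Q d π₀ i).mulVecLin
            (HyperbolicQuadric.eigenP (Nat.card F) d j (2 * i)) ∧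
        (HyperbolicQuadric.eigenP (Nat.card F) d j (2 * i) =
          HyperbolicQuadric.eigenP (Nat.card F) d 1 (2 * i) ↔ j = 1)) ∧
      -- the whole eigenspace of `A'_i` for `P_{1,2i}` is `V'_1`
      Module.End.eigenspace (HyperbolicQuadric.classMatrix Q d π₀ i).mulVecLin
          (HyperbolicQuadric.eigenP (Nat.card F) d 1 (2 * i)) =
        HyperbolicQuadric.classSpace Q d π₀ 1 := by
  have hq := HyperbolicQuadric.two_le_card F
  refine ⟨⟨fun j hj k hk hjk u hu w hw =>
    HyperbolicQuadric.IsHyperbolic.schemeSpace_orthogonal hj hk hjk hu hw, ?_⟩,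
    fun i hi hid => ⟨fun j hj => ⟨hQ.classSpace_ne_bot hd π₀ (by omega),
      hQ.classSpace_le_eigenspace π₀ hid (by omega),
      HyperbolicQuadric.eigenP_eq_eigenP_one_iff hq hi hid (by omega)⟩,
      le_antisymm (hQ.eigenspace_le_classSpace_one π₀ hi hid)
        (hQ.classSpace_le_eigenspace π₀ hid (by omega))⟩⟩
  refine eq_top_iff.2 fun v _ => ?_
  obtain ⟨x, hx, rfl⟩ := hQ.exists_decomposition v
  exact Submodule.sum_mem _ fun j hj => Submodule.mem_iSup_of_mem j
    (Submodule.mem_iSup_of_mem hj (hx j (Nat.lt_succ_iff.1 (Finset.mem_range.1 hj))))
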